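/- Let $M,N\ge 1$ and let $\mathbf H$ be a random $N\times M$ matrix whose entries are i.i.d. circularly symmetric complex Gaussian with mean $0$ and variance $1$ (the channel estimate of a link with $M$ transmit and $N$ receive antennas, normalized to unit variance). Let $R,R_0,a,\sigma^2,L,S_d>0$, $b\ge 0$, $T_s>M$, and put $\xi=R/R_0$ and $T=T_sS_d$. For a transmit power $P>0$ and a training time $t=t_sS_d$, corresponding to $t_s$ training symbols, define the energy efficiency $$\nu_R(P,t)=\frac{R\left(1-\frac tT\right)\Pr\left[\log_2\det\left(\mathbf I_N+\frac{1}{M}\,\rho_{\mathrm{eff}}\!\left(\tfrac{LP}{\sigma^2},t\right)\mathbf H\mathbf H^H\right)\ge\xi\right]}{aP+b},\qquad \rho_{\mathrm{eff}}(\rho,t)=\frac{\frac{t}{MS_d}\rho^2}{1+\rho+\rho\frac{t}{MS_d}} .$$ For each $P>0$ let $t_s^*(P)$ be an optimal number of training symbols, i.e. a maximizer of $t_s\mapsto\nu_R(P,t_sS_d)$ over $M\le t_s<T_s$. Then such a maximizer exists for every $P>0$, and for any choice of maximizers $$\lim_{P\to+\infty}t_s^*(P)=M .$$ This holds both when $t_s$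 ranges over the real numbers and when $t_s$ ranges over the integers with $M\le t_s<T_s$. -/

import Mathlib

open MeasureTheory ProbabilityTheory Filter Topology

noncomputable section

/-- The circularly symmetric complex Gaussian law with mean `0` and variance `1`: the real and
the imaginary part are independent centred Gaussians of variance `1 / 2`. -/
def stdComplexGaussian : Measure ℂ :=
  ((gaussianReal 0 (1 / 2)).prod (gaussianReal 0 (1 / 2))).map
    Complex.measurableEquivRealProd.symm

/-- A random `N × M` channel matrix whose entries are independent zero-mean unit-variance
complex Gaussian random variables. -/
structure IsRayleighChannel {Ω : Type*} [MeasurableSpace Ω] (μ : Measure Ω) {N M : ℕ}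
    (H : Ω → Matrix (Fin N) (Fin M) ℂ) : Prop where
  /-- each entry is a standard complex Gaussian -/
  law : ∀ i j, HasLaw (fun ω => H ω i j) stdComplexGaussian μ
  /-- the `N * M` entries are mutually independent -/
  indep : iIndepFun (fun (ij : Fin N × Fin M) ω => H ω ij.1 ij.2) μ

/-- The scalar parameters of a training-based MIMO link. -/
structure LinkParams where
  /-- transmission rate -/
  R : ℝ
  /-- bandwidth-like normalisation of the rate -/
  R₀ : ℝ
  /-- slope of the total consumed power as a function of the radiated power -/
  a : ℝ
  /-- power consumed when nothing is radiated -/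
  b : ℝ
  /-- reception noise variance -/
  noise : ℝ
  /-- the factor multiplying `P / σ²` in the SNR -/
  L : ℝ
  /-- symbol duration -/
  Sd : ℝ
  /-- block length in symbols -/
  Ts : ℝ
  R_pos : 0 < R
  R₀_pos : 0 < R₀
  a_pos : 0 < a
  b_nonneg : 0 ≤ b
  noise_pos : 0 < noise
  L_pos : 0 < L
  Sd_pos : 0 < Sd

namespace LinkParams

/-- The spectral efficiency `ξ = R / R₀`. -/
def xi (p : LinkParams) : ℝ := p.R / p.R₀

/-- The block duration `T = T_s S_d`. -/
def T (p : LinkParams) : ℝ := p.Ts * p.Sd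

/-- The SNR `ρ = L P / σ²` at transmit power `P`. -/
def snr (p : LinkParams) (P : ℝ) : ℝ := p.L * P / p.noise

/-- The effective SNR `ρ_eff(ρ, t)` when the `M` transmit antennas are trained for a time `t`. -/
def effSNR (p : LinkParams) (M : ℕ) (ρ t : ℝ) : ℝ :=
  t / (M * p.Sd) * ρ ^ 2 / (1 + ρ + ρ * (t / (M * p.Sd)))

end LinkParams

open Matrix in
/-- `log₂ det (I + (ρ / M) H Hᴴ)`, where the determinant is a (positive) real number. -/
def mutualInfo {N M : ℕ} (ρ : ℝ) (H : Matrix (Fin N) (Fin M) ℂ) : ℝ :=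
  Real.logb 2 (1 + ((ρ / M : ℝ) : ℂ) • (H * Hᴴ)).det.re

/-- The success probability `f(ρ) = Pr [log₂ det (I + (ρ / M) H Hᴴ) ≥ ξ]`. -/
def successProb {Ω : Type*} [MeasurableSpace Ω] (μ : Measure Ω) {N M : ℕ}
    (H : Ω → Matrix (Fin N) (Fin M) ℂ) (ξ ρ : ℝ) : ℝ :=
  μ.real {ω | ξ ≤ mutualInfo ρ (H ω)}

namespace LinkParams

/-- The energy efficiency
`ν_R(P, t) = R (1 - t / T) Pr [I_ICSIR(P, t, H) ≥ ξ] / (a P + b)`, where `t` is the training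
time in seconds and `H` is the channel estimate normalised to unit variance. -/
def energyEff (p : LinkParams) {Ω : Type*} [MeasurableSpace Ω] (μ : Measure Ω) {N M : ℕ}
    (H : Ω → Matrix (Fin N) (Fin M) ℂ) (P t : ℝ) : ℝ :=
  p.R * (1 - t / p.T) * successProb μ H p.xi (p.effSNR M (p.snr P) t) / (p.a * P + p.b)

/-- The admissible training lengths in symbols, `M ≤ t_s < T_s`, `t_s` real. -/
def lengths (p : LinkParams) (M : ℕ) : Set ℝ := Set.Ico (M : ℝ) p.Ts

/-- The admissible training lengths that are whole numbers of symbols. -/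
def integerLengths (p : LinkParams) (M : ℕ) : Set ℝ :=
  {ts | ts ∈ p.lengths M ∧ ∃ n : ℕ, ts = n}

/-- `ts` is an optimal number of training symbols within `A` for the transmit power `P`: it
maximises `ν_R(P, ts * S_d)` over `A`. -/
def IsOptimalLength (p : LinkParams) {Ω : Type*} [MeasurableSpace Ω] (μ : Measure Ω) {N M : ℕ}
    (H : Ω → Matrix (Fin N) (Fin M) ℂ) (A : Set ℝ) (P ts : ℝ) : Prop :=
  ts ∈ A ∧ ∀ s ∈ A, p.energyEff μ H P (s * p.Sd) ≤ p.energyEff μ H P (ts * p.Sd)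

end LinkParams

end

/-! For fixed `P > 0` the objective is, up to a positive factor, `(1 - s / Ts)` times the success
probability. Since `det (I + c X Xᴴ) ≥ 1 + c |X i j|²` and an entry is almost surely nonzero, the
mutual information tends to infinity with the SNR and the success probability tends to `1`. Training
for `M` symbols already sends the effective SNR to infinity with `P`, so the value at `M` tends to
`1 - M / Ts`, while a length `s ≥ y > M` never yields more than `1 - y / Ts`. Maximizers over real
lengths exist because the success probability is upper semicontinuous, which avoids studying the law
of the determinant; over integers the set is finite. -/

theorem one_add_sum_le_prod_one_add {ι : Type*} (s : Finset ι) (f : ι → ℝ)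
    (hf : ∀ i ∈ s, 0 ≤ f i) : 1 + ∑ i ∈ s, f i ≤ ∏ i ∈ s, (1 + f i) := by
  classical
  induction s using Finset.induction_on with
  | empty => simp
  | insert a s ha ih =>
    rw [Finset.sum_insert ha, Finset.prod_insert ha]
    have h0 := hf a (Finset.mem_insert_self a s)
    have hs := fun i hi => hf i (Finset.mem_insert_of_mem hi)
    have h1 := ih hs
    have h2 := Finset.sum_nonneg hs
    nlinarith

open Matrix ComplexOrder in
/-- `det (I + B) ≥ 1 + tr B` for a positive semidefinite matrix `B`. -/
theorem Matrix.PosSemidef.one_add_trace_le_det {n : Type*} [Fintype n] [DecidableEq n]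
    {B : Matrix n n ℂ} (hB : B.PosSemidef) : 1 + B.trace.re ≤ (1 + B).det.re := by
  -- Diagonalizing `1 + B` rather than `B` makes the determinant directly a product of eigenvalues,
  -- each at least `1`.
  have hA : (1 + B).IsHermitian := Matrix.isHermitian_one.add hB.1
  have h1 : ∀ i, 1 ≤ hA.eigenvalues i := by
    intro i
    rw [hA.eigenvalues_eq i, Matrix.add_mulVec, dotProduct_add, Matrix.one_mulVec]
    have h := hB.re_dotProduct_nonneg (hA.eigenvectorBasis i)
    have hv : star ⇑(hA.eigenvectorBasis i) ⬝ᵥ ⇑(hA.eigenvectorBasis i) = 1 := by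
      rw [dotProduct_comm, ← EuclideanSpace.inner_eq_star_dotProduct]
      simp [inner_self_eq_norm_sq_to_K]
    rw [hv, map_add]
    simpa using h
  have hdet : (1 + B).det.re = ∏ i, hA.eigenvalues i := by
    rw [hA.det_eq_prod_eigenvalues]
    norm_cast
  have htr : (Fintype.card n : ℝ) + B.trace.re = ∑ i, hA.eigenvalues i := by
    have := congrArg Complex.re hA.trace_eq_sum_eigenvalues
    rw [Matrix.trace_add, Matrix.trace_one] at this
    simpa using this
  have h := one_add_sum_le_prod_one_add Finset.univ (fun i => hA.eigenvalues i - 1)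
    (fun i _ => sub_nonneg.2 (h1 i))
  simp only [Finset.sum_sub_distrib, add_sub_cancel, ← htr, ← hdet] at h
  simp at h
  linarith

-- The trace of `X Xᴴ` is the sum of all squared moduli, so a single entry bounds it below. This
-- gives both positivity of the determinant and its growth in `c`.
open Matrix ComplexOrder in
theorem one_add_mul_normSq_le_det_re {N M : ℕ} {c : ℝ} (hc : 0 ≤ c)
    (X : Matrix (Fin N) (Fin M) ℂ) (i : Fin N) (j : Fin M) :
    1 + c * Complex.normSq (X i j) ≤ (1 + (c : ℂ) • (X * Xᴴ)).det.re := by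
  have hB : ((c : ℂ) • (X * Xᴴ)).PosSemidef :=
    (Matrix.posSemidef_self_mul_conjTranspose X).smul (by exact_mod_cast hc)
  refine le_trans ?_ hB.one_add_trace_le_det
  have htr : (X * Xᴴ).trace.re = ∑ k, ∑ l, Complex.normSq (X k l) := by
    simp [Matrix.trace, Matrix.mul_apply, Complex.mul_conj]
  rw [Matrix.trace_smul, smul_eq_mul, Complex.re_ofReal_mul, htr]
  gcongr
  calc Complex.normSq (X i j) ≤ ∑ l, Complex.normSq (X i l) :=
        Finset.single_le_sum (f := fun l => Complex.normSq (X i l))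
          (fun l _ => Complex.normSq_nonneg _) (Finset.mem_univ j)
    _ ≤ _ := Finset.single_le_sum (f := fun k => ∑ l, Complex.normSq (X k l))
          (fun k _ => Finset.sum_nonneg fun l _ => Complex.normSq_nonneg _) (Finset.mem_univ i)

/-! ### Semicontinuity and Fatou -/

theorem upperSemicontinuousOn_mul_of_continuousOn {α : Type*} [TopologicalSpace α] {s : Set α}
    {u f : α → ℝ} (hu : ContinuousOn u s) (hu0 : ∀ x ∈ s, 0 ≤ u x)
    (hf : UpperSemicontinuousOn f s) : UpperSemicontinuousOn (fun x => u x * f x) s := by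
  intro x hx y hy
  obtain ⟨c, hcy, hfc⟩ : ∃ c, u x * c < y ∧ f x < c := by
    have : ContinuousAt (fun c => u x * c) (f x) := by fun_prop
    exact (((this.eventually_lt continuousAt_const hy).filter_mono nhdsWithin_le_nhds).and
      (self_mem_nhdsWithin (s := Set.Ioi (f x)))).exists
  filter_upwards [hf x hx c hfc, ((hu x hx).mul_const c).eventually_lt_const hcy,
    self_mem_nhdsWithin] with z hz1 hz2 hzs
  exact (mul_le_mul_of_nonneg_left hz1.le (hu0 z hzs)).trans_lt hz2

/-- A form of Fatou's lemma for sets. -/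
theorem eventually_lt_measureReal {Ω ι : Type*} [MeasurableSpace Ω] {μ : Measure Ω}
    [IsFiniteMeasure μ] {l : Filter ι} [l.IsCountablyGenerated] {S : Set Ω} {A : ι → Set Ω}
    (hS : NullMeasurableSet S μ) (hA : ∀ i, NullMeasurableSet (A i) μ)
    (h : ∀ᵐ ω ∂μ, ω ∈ S → ∀ᶠ i in l, ω ∈ A i) {y : ℝ} (hy : y < μ.real S) :
    ∀ᶠ i in l, y < μ.real (A i) := by
  -- `ENNReal.ofReal` truncates negative values, so these are treated apart.
  rcases lt_or_ge y 0 with h0 | h0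
  · exact Eventually.of_forall fun i => h0.trans_le measureReal_nonneg
  have key : μ S ≤ liminf (fun i => μ (A i)) l := by
    calc μ S = ∫⁻ ω, S.indicator 1 ω ∂μ := (lintegral_indicator_one₀ hS).symm
      _ ≤ ∫⁻ ω, liminf (fun i => (A i).indicator (1 : Ω → ENNReal) ω) l ∂μ := by
        refine lintegral_mono_ae ?_
        filter_upwards [h] with ω hω
        by_cases hωS : ω ∈ S
        · rw [Set.indicator_of_mem hωS]
          refine le_liminf_of_le (by isBoundedDefault) ?_
          filter_upwards [hω hωS] with i hi
          rw [Set.indicator_of_mem hi]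
        · simp [hωS]
      _ ≤ liminf (fun i => ∫⁻ ω, (A i).indicator 1 ω ∂μ) l :=
        lintegral_liminf_le' fun i => aemeasurable_const.indicator₀ (hA i)
      _ = _ := by simp_rw [lintegral_indicator_one₀ (hA _)]
  have hlt : ENNReal.ofReal y < liminf (fun i => μ (A i)) l :=
    ((ENNReal.ofReal_lt_iff_lt_toReal h0 (measure_ne_top _ _)).2 hy).trans_le key
  filter_upwards [eventually_lt_of_lt_liminf hlt] with i hi
  exact (ENNReal.ofReal_lt_iff_lt_toReal h0 (measure_ne_top _ _)).1 hi

theorem stdComplexGaussian_singleton (z : ℂ) : stdComplexGaussian {z} = 0 := by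
  have := nullSingletonClass_gaussianReal (μ := 0) (v := 1 / 2) (by simp)
  rw [stdComplexGaussian, MeasurableEquiv.map_apply]
  have : Complex.measurableEquivRealProd.symm ⁻¹' {z} = {z.re} ×ˢ {z.im} := by
    ext ⟨x, y⟩
    simp [Complex.ext_iff]
  rw [this, Measure.prod_prod, measure_singleton, zero_mul]

/-! ### Success probability of the channel -/

section
variable {Ω : Type*} [MeasurableSpace Ω] {μ : Measure Ω} {N M : ℕ}
  {H : Ω → Matrix (Fin N) (Fin M) ℂ}

theorem IsRayleighChannel.ae_entry_ne_zero (hH : IsRayleighChannel μ H) (i : Fin N) (j : Fin M) :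
    ∀ᵐ ω ∂μ, H ω i j ≠ 0 := by
  rw [ae_iff]
  have := (hH.law i j).measure_eq (p := fun z => z = 0) (measurableSet_singleton 0)
  simpa using this.trans (stdComplexGaussian_singleton 0)

open Matrix in
theorem IsRayleighChannel.aemeasurable_mutualInfo (hH : IsRayleighChannel μ H) (ρ : ℝ) :
    AEMeasurable (fun ω => mutualInfo ρ (H ω)) μ := by
  have h : ∀ i j, AEMeasurable (fun ω => H ω i j) μ := fun i j => (hH.law i j).aemeasurable
  unfold mutualInfo Real.logb
  refine (Real.measurable_log.comp_aemeasurable (Complex.measurable_re.comp_aemeasurable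
    ?_)).div_const _
  simp only [Matrix.det_apply', Matrix.add_apply, Matrix.smul_apply, Matrix.mul_apply,
    Matrix.conjTranspose_apply, smul_eq_mul]
  refine Finset.aemeasurable_fun_sum _ fun σ _ => AEMeasurable.const_mul ?_ _
  refine Finset.aemeasurable_fun_prod _ fun i _ => aemeasurable_const.add ?_
  refine AEMeasurable.const_mul (Finset.aemeasurable_fun_sum _ fun k _ => (h _ _).mul ?_) _
  exact Complex.continuous_conj.measurable.comp_aemeasurable (h _ _)

open Matrix in
theorem continuousAt_mutualInfo (X : Matrix (Fin N) (Fin M) ℂ) (hM : 0 < M) (hN : 0 < N)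
    {ρ : ℝ} (hρ : 0 ≤ ρ) : ContinuousAt (fun r => mutualInfo r X) ρ := by
  have h := one_add_mul_normSq_le_det_re (c := ρ / M) (by positivity) X ⟨0, hN⟩ ⟨0, hM⟩
  have h' : 0 ≤ ρ / M * Complex.normSq (X ⟨0, hN⟩ ⟨0, hM⟩) :=
    mul_nonneg (by positivity) (Complex.normSq_nonneg _)
  unfold mutualInfo Real.logb
  refine (ContinuousAt.log ?_ (by linarith)).div_const _
  refine Continuous.continuousAt (Complex.continuous_re.comp (Continuous.matrix_det ?_))
  fun_prop

theorem tendsto_mutualInfo_atTop {X : Matrix (Fin N) (Fin M) ℂ} {i : Fin N} {j : Fin M}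
    (hX : X i j ≠ 0) (hM : 0 < M) : Tendsto (fun ρ => mutualInfo ρ X) atTop atTop := by
  have hpos := Complex.normSq_pos.2 hX
  have hM' : (0 : ℝ) < M := by exact_mod_cast hM
  refine (Real.tendsto_logb_atTop one_lt_two).comp ?_
  refine tendsto_atTop_mono' _ (f₁ := fun ρ : ℝ => 1 + ρ / M * Complex.normSq (X i j)) ?_ ?_
  · filter_upwards [eventually_ge_atTop 0] with ρ hρ
    exact one_add_mul_normSq_le_det_re (by positivity) X i j
  · exact tendsto_atTop_add_const_left _ _
      ((tendsto_id.atTop_div_const hM').atTop_mul_const hpos)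

theorem IsRayleighChannel.nullMeasurableSet_success (hH : IsRayleighChannel μ H) (ξ ρ : ℝ) :
    NullMeasurableSet {ω | ξ ≤ mutualInfo ρ (H ω)} μ :=
  (hH.aemeasurable_mutualInfo ρ).nullMeasurable measurableSet_Ici

theorem successProb_nonneg (ξ ρ : ℝ) : 0 ≤ successProb μ H ξ ρ := measureReal_nonneg

variable [IsProbabilityMeasure μ]

theorem successProb_le_one (ξ ρ : ℝ) : successProb μ H ξ ρ ≤ 1 := measureReal_le_one

/-- Failure is a strict inequality, hence for each outcome it persists under small changes of `ρ`;
Fatou then applies to the failure events. -/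
theorem IsRayleighChannel.upperSemicontinuousAt_successProb (hH : IsRayleighChannel μ H)
    (hM : 0 < M) (hN : 0 < N) (ξ : ℝ) {ρ : ℝ} (hρ : 0 ≤ ρ) :
    UpperSemicontinuousAt (successProb μ H ξ) ρ := by
  intro y hy
  have hcompl : ∀ r, μ.real {ω | ξ ≤ mutualInfo r (H ω)}ᶜ = 1 - successProb μ H ξ r := fun r => by
    rw [← probReal_univ (μ := μ), successProb]
    exact measureReal_compl₀ (hH.nullMeasurableSet_success ξ r)
  have := eventually_lt_measureReal (μ := μ) (l := 𝓝 ρ)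
    (hH.nullMeasurableSet_success ξ ρ).compl
    (fun r => (hH.nullMeasurableSet_success ξ r).compl) (Eventually.of_forall fun ω hω => ?_)
    (y := 1 - y) (by rw [hcompl]; linarith)
  · filter_upwards [this] with r hr
    rw [hcompl] at hr
    linarith
  · simp only [Set.mem_compl_iff, Set.mem_ofPred_eq, not_le] at hω ⊢
    exact (continuousAt_mutualInfo (H ω) hM hN hρ).eventually_lt continuousAt_const hω

theorem IsRayleighChannel.tendsto_successProb_atTop (hH : IsRayleighChannel μ H)
    (hM : 0 < M) (hN : 0 < N) (ξ : ℝ) : Tendsto (successProb μ H ξ) atTop (𝓝 1) := by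
  refine tendsto_order.2 ⟨fun y hy => ?_, fun y hy =>
    Eventually.of_forall fun r => (successProb_le_one ξ r).trans_lt hy⟩
  refine eventually_lt_measureReal (μ := μ) MeasurableSet.univ.nullMeasurableSet
    (fun r => hH.nullMeasurableSet_success ξ r) ?_ (by simpa using hy)
  filter_upwards [hH.ae_entry_ne_zero ⟨0, hN⟩ ⟨0, hM⟩] with ω hω _
  exact (tendsto_mutualInfo_atTop hω hM).eventually_ge_atTop ξ
end

/-! ### Effective SNR and optimal training lengths -/

namespace LinkParams
variable (p : LinkParams)

theorem effSNR_mul_Sd (M : ℕ) (ρ s : ℝ) :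
    p.effSNR M ρ (s * p.Sd) = s / M * ρ ^ 2 / (1 + ρ + ρ * (s / M)) := by
  rw [effSNR, mul_div_mul_right _ _ p.Sd_pos.ne']

theorem effSNR_nonneg (M : ℕ) {ρ s : ℝ} (hρ : 0 ≤ ρ) (hs : 0 ≤ s) :
    0 ≤ p.effSNR M ρ (s * p.Sd) := by
  rw [effSNR_mul_Sd]
  positivity

theorem continuousAt_effSNR (M : ℕ) {ρ s : ℝ} (hρ : 0 ≤ ρ) (hs : 0 ≤ s) :
    ContinuousAt (fun t => p.effSNR M ρ (t * p.Sd)) s := by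
  simp_rw [effSNR_mul_Sd]
  have : 1 + ρ + ρ * (s / M) ≠ 0 := by positivity
  fun_prop (disch := assumption)

/-- With one training symbol per antenna the effective SNR is at least `ρ / 3` once `ρ ≥ 1`. -/
theorem tendsto_effSNR_atTop {M : ℕ} (hM : 0 < M) :
    Tendsto (fun P => p.effSNR M (p.snr P) (M * p.Sd)) atTop atTop := by
  have hM' : (M : ℝ) ≠ 0 := by exact_mod_cast hM.ne'
  have hsnr : Tendsto p.snr atTop atTop :=
    (tendsto_id.const_mul_atTop p.L_pos).atTop_div_const p.noise_pos
  refine Tendsto.comp (g := fun ρ => p.effSNR M ρ (M * p.Sd)) ?_ hsnr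
  refine tendsto_atTop_mono' _ (f₁ := fun ρ : ℝ => ρ / 3) ?_
    (tendsto_id.atTop_div_const three_pos)
  filter_upwards [eventually_ge_atTop 1] with ρ hρ
  rw [effSNR_mul_Sd, div_self hM', le_div_iff₀ (by positivity)]
  nlinarith

section
variable {Ω : Type*} [MeasurableSpace Ω] {μ : Measure Ω} {N M : ℕ}
  {H : Ω → Matrix (Fin N) (Fin M) ℂ}

theorem energyEff_mul_Sd (P s : ℝ) :
    p.energyEff μ H P (s * p.Sd) = p.R / (p.a * P + p.b) *
      ((1 - s / p.Ts) * successProb μ H p.xi (p.effSNR M (p.snr P) (s * p.Sd))) := by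
  rw [energyEff, T, mul_div_mul_right _ _ p.Sd_pos.ne']
  ring

theorem energyEff_factor_pos {P : ℝ} (hP : 0 < P) : 0 < p.R / (p.a * P + p.b) :=
  div_pos p.R_pos (add_pos_of_pos_of_nonneg (mul_pos p.a_pos hP) p.b_nonneg)

variable {p}

theorem energyEff_le_iff {P s t : ℝ} (hP : 0 < P) :
    p.energyEff μ H P (s * p.Sd) ≤ p.energyEff μ H P (t * p.Sd) ↔
      (1 - s / p.Ts) * successProb μ H p.xi (p.effSNR M (p.snr P) (s * p.Sd)) ≤
      (1 - t / p.Ts) * successProb μ H p.xi (p.effSNR M (p.snr P) (t * p.Sd)) := by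
  rw [energyEff_mul_Sd, energyEff_mul_Sd, mul_le_mul_iff_right₀ (p.energyEff_factor_pos hP)]

theorem exists_isOptimalLength_integer (hTs : (M : ℝ) < p.Ts) (P : ℝ) :
    ∃ ts, p.IsOptimalLength μ H (p.integerLengths M) P ts := by
  have hfin : (p.integerLengths M).Finite := by
    refine ((Set.finite_Iic ⌊p.Ts⌋₊).image (fun n : ℕ => (n : ℝ))).subset ?_
    rintro _ ⟨h, n, rfl⟩
    exact ⟨n, Nat.le_floor h.2.le, rfl⟩
  obtain ⟨s, hs, hmax⟩ := hfin.exists_maximalFor (fun s => p.energyEff μ H P (s * p.Sd)) _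
    ⟨M, ⟨le_rfl, hTs⟩, M, rfl⟩
  exact ⟨s, hs, fun t ht => (le_total _ _).elim id (hmax ht)⟩

variable [IsProbabilityMeasure μ]

theorem exists_isOptimalLength (hH : IsRayleighChannel μ H) (hM : 0 < M) (hN : 0 < N)
    (hTs : (M : ℝ) < p.Ts) {P : ℝ} (hP : 0 < P) :
    ∃ ts, p.IsOptimalLength μ H (p.lengths M) P ts := by
  have hM0 : (0 : ℝ) ≤ M := M.cast_nonneg
  have hT0 : 0 < p.Ts := hM0.trans_lt hTs
  have hsnr : 0 ≤ p.snr P := div_nonneg (mul_nonneg p.L_pos.le hP.le) p.noise_pos.le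
  -- Adding the endpoint `Ts` makes the domain compact.
  have husc : UpperSemicontinuousOn (fun s => (1 - s / p.Ts) *
      successProb μ H p.xi (p.effSNR M (p.snr P) (s * p.Sd))) (Set.Icc (M : ℝ) p.Ts) := by
    refine upperSemicontinuousOn_mul_of_continuousOn (by fun_prop)
      (fun s hs => sub_nonneg.2 ((div_le_one hT0).2 hs.2)) fun s hs y hy => ?_
    have hs0 := hM0.trans hs.1
    exact ((p.continuousAt_effSNR M hsnr hs0).eventually
      (hH.upperSemicontinuousAt_successProb hM hN p.xi (p.effSNR_nonneg M hsnr hs0) y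
        hy)).filter_mono nhdsWithin_le_nhds
  obtain ⟨s, hs, hmax⟩ := husc.exists_isMaxOn (Set.nonempty_Icc.2 hTs.le) isCompact_Icc
  rcases hs.2.lt_or_eq with hlt | heq
  · exact ⟨s, ⟨hs.1, hlt⟩, fun t ht => (energyEff_le_iff hP).2 (hmax ⟨ht.1, ht.2.le⟩)⟩
  -- If the maximum sits at `Ts`, its value is `0`, and the nonnegative value at `M` does as well.
  · refine ⟨M, ⟨le_rfl, hTs⟩, fun t ht => (energyEff_le_iff hP).2 ?_⟩
    refine (hmax ⟨ht.1, ht.2.le⟩).trans ?_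
    simp only [heq, div_self hT0.ne', sub_self, zero_mul]
    exact mul_nonneg (sub_nonneg.2 ((div_le_one hT0).2 hTs.le)) (successProb_nonneg _ _)

/-- At high power, training beyond `M` symbols costs more than the unit success probability can
give back. -/
theorem tendsto_isOptimalLength (hH : IsRayleighChannel μ H) (hM : 0 < M) (hN : 0 < N)
    (hTs : (M : ℝ) < p.Ts) {A : Set ℝ} (hA : A ⊆ p.lengths M) (hMA : (M : ℝ) ∈ A)
    {tstar : ℝ → ℝ} (h : ∀ᶠ P in atTop, p.IsOptimalLength μ H A P (tstar P)) :
    Tendsto tstar atTop (𝓝 (M : ℝ)) := by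
  have hT0 : 0 < p.Ts := M.cast_nonneg.trans_lt hTs
  refine tendsto_order.2 ⟨fun y hy => ?_, fun y hy => ?_⟩
  · filter_upwards [h] with P hP using hy.trans_le (hA hP.1).1
  · have hlim : Tendsto (fun P => (1 - M / p.Ts) *
        successProb μ H p.xi (p.effSNR M (p.snr P) (M * p.Sd))) atTop (𝓝 ((1 - M / p.Ts) * 1)) :=
      ((hH.tendsto_successProb_atTop hM hN p.xi).comp (p.tendsto_effSNR_atTop hM)).const_mul _
    have hlt : 1 - y / p.Ts < (1 - M / p.Ts) * 1 := by
      rw [mul_one]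
      gcongr
    filter_upwards [h, hlim.eventually_const_lt hlt, eventually_gt_atTop 0] with P hopt hP hP0
    by_contra! hge
    have hle := (energyEff_le_iff hP0).1 (hopt.2 M hMA)
    have hts : 0 ≤ 1 - tstar P / p.Ts := sub_nonneg.2 ((div_le_one hT0).2 (hA hopt.1).2.le)
    have h1 := mul_le_of_le_one_right hts
      (successProb_le_one (μ := μ) (H := H) p.xi (p.effSNR M (p.snr P) (tstar P * p.Sd)))
    have h2 : y / p.Ts ≤ tstar P / p.Ts := by gcongr
    linarith

end
end LinkParams

theorem proposition3 {Ω : Type*} [MeasurableSpace Ω] (μ : Measure Ω) [IsProbabilityMeasure μ]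
    {M N : ℕ} (hM : 0 < M) (hN : 0 < N)
    (H : Ω → Matrix (Fin N) (Fin M) ℂ) (hH : IsRayleighChannel μ H)
    (p : LinkParams) (hTs : (M : ℝ) < p.Ts) :
    ((∀ P : ℝ, 0 < P → ∃ ts : ℝ, p.IsOptimalLength μ H (p.lengths M) P ts) ∧
      ∀ tstar : ℝ → ℝ,
        (∀ᶠ P in atTop, p.IsOptimalLength μ H (p.lengths M) P (tstar P)) →
          Tendsto tstar atTop (𝓝 (M : ℝ))) ∧
    ((∀ P : ℝ, 0 < P → ∃ ts : ℝ, p.IsOptimalLength μ H (p.integerLengths M) P ts) ∧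
      ∀ tstar : ℝ → ℝ,
        (∀ᶠ P in atTop, p.IsOptimalLength μ H (p.integerLengths M) P (tstar P)) →
          Tendsto tstar atTop (𝓝 (M : ℝ))) := by

  have hmem : (M : ℝ) ∈ p.lengths M := ⟨le_rfl, hTs⟩
  exact ⟨⟨fun P hP => LinkParams.exists_isOptimalLength hH hM hN hTs hP, fun tstar h =>
      LinkParams.tendsto_isOptimalLength hH hM hN hTs subset_rfl hmem h⟩,
    ⟨fun P _ => LinkParams.exists_isOptimalLength_integer hTs P, fun tstar h =>
      LinkParams.tendsto_isOptimalLength hH hM hN hTs (A := p.integerLengths M)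
        (fun _ hs => hs.1) ⟨hmem, M, rfl⟩ h⟩⟩
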